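/- **Proposition 4.10.** For an ideal $I$ of a commutative ring $A$ and $f\in A$ put $\operatorname{ord}_I(f)=\sup\{\ell\in\mathbb N : f\in I^\ell\}\in\mathbb N\cup\{\infty\}$ and $\overline\nu_I(f)=\lim_{n\to\infty}\operatorname{ord}_I(f^n)/n$. An ideal $I\subseteq J$ is a *reduction* of $J$ if $IJ^{n}=J^{n+1}$ for some $n\ge 0$. Let $(v_1,\dots,v_n)$ be a regular system of parameters of a regular local ring $(R,\mathfrak m)$. A *CP-expansion* of $f\in R$ with respect to $v$ is an expression $f=\sum_{\alpha\in S(f)}c_\alpha(f)\, v^\alpha$, where $S(f)\subset\mathbb N^n$ is finite, every $c_\alpha(f)\in R$ is a unit, and $\{v^\alpha\}_{\alpha\in S(f)}$ is a minimal set of generators of the ideal that it generates. If $(u_1,\dots,u_d)$ is part of a regular system of parameters of $R$, then $g\in R$ *has a $(u)$-CP-expansion* if $u$ can be completed to a regular system of parameters $(u,y)=(u_1,\dots,u_d,y_1,\dots,y_e)$ for which $g$ has a CP-expansion with respect to $(u,y)$ with $S(g)\subset\mathbb N^d\times\{0\}$, that is, $g=\sum_{(\alpha,0)\in S(g)}c_{(\alpha,0)}(g)\,u^\alpha$.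 Let $(R,\mathfrak m)$ be a regular local ring, let $(u_1,\dots,u_d)$ be part of a regular system of parameters of $R$, and let $\mathfrak a\subset R$ be an ideal such that the ring $R'=R/\mathfrak a$ has dimension $d$ and its maximal ideal $\mathfrak m'$ has a reduction generated by the classes $u_1',\dots,u_d'\in R'$. Let $g\in R$ have a $(u)$-CP-expansion, $g=\sum_{(\alpha,0)\in S(g)}c_{(\alpha,0)}(g)\,u^\alpha$, and let $g'\in R'$ be the class of $g$. Then the limit defining $\overline\nu_{\mathfrak m'}(g')$ exists in $[0,\infty]$ and $$\overline\nu_{\mathfrak m'}(g')=\operatorname{ord}_{\mathfrak m}(g)=\min\{|\alpha| : (\alpha,0)\in S(g)\},$$ where $|\alpha|=\alpha_1+\dots+\alpha_d$ and the minimum is $\infty$ when $S(g)=\emptyset$ (that is, when $g=0$). -/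

import Mathlib

open Filter Topology
open scoped ENNReal

/-- The order of `f` along the ideal `I`: the supremum of the `l` such that `f ∈ I ^ l`. -/
noncomputable def idealOrder {A : Type*} [CommRing A] (I : Ideal A) (f : A) : ℕ∞ :=
  ⨆ (l : ℕ) (_ : f ∈ I ^ l), (l : ℕ∞)

/-- The asymptotic Samuel function `lim_n ord_I (f ^ n) / n` of the ideal `I`, with values
in `[0, ∞]`. -/
noncomputable def asymptoticSamuel {A : Type*} [CommRing A] (I : Ideal A) (f : A) : ℝ≥0∞ :=
  limUnder atTop (fun n : ℕ => (idealOrder I (f ^ n) : ℝ≥0∞) / (n : ℝ≥0∞))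

/-- `I` is a reduction of `J`. -/
def IsIdealReduction {A : Type*} [CommRing A] (I J : Ideal A) : Prop :=
  I ≤ J ∧ ∃ n : ℕ, I * J ^ n = J ^ (n + 1)

/-- The finite family `v` is a regular system of parameters of the local ring `R`: it generates
the maximal ideal and its number of members is the dimension of `R`. -/
def IsRegularSystemOfParameters {R : Type*} [CommRing R] [IsLocalRing R]
    {ι : Type*} [Fintype ι] (v : ι → R) : Prop :=
  Ideal.span (Set.range v) = IsLocalRing.maximalIdeal R ∧ ringKrullDim R = Fintype.card ι

/-- The monomial `v ^ α`. -/
def systemMonomial {R : Type*} [CommRing R] {ι : Type*} [Fintype ι] (v : ι → R) (α : ι → ℕ) : R :=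
  ∏ i, v i ^ α i

/-- `f = ∑ α ∈ S, c α * v ^ α` is a Cossart-Piltant expansion of `f` with respect to `v`: the
coefficients are units, and the monomials `v ^ α`, `α ∈ S`, are a minimal set of generators of
the ideal that they generate. -/
structure IsCPExpansion {R : Type*} [CommRing R] {ι : Type*} [Fintype ι] (v : ι → R) (f : R)
    (S : Finset (ι → ℕ)) (c : (ι → ℕ) → R) : Prop where
  minimal : ∀ α ∈ S,
    systemMonomial v α ∉ Ideal.span (systemMonomial v '' {β | β ∈ S ∧ β ≠ α})
  isUnit_coeff : ∀ α ∈ S, IsUnit (c α)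
  eq_sum : f = ∑ α ∈ S, c α * systemMonomial v α

/-- Let `u` be part of a regular system of parameters, completed by `y`. The data `S`, `c` are
a `(u)`-CP-expansion of `g`: they are a CP-expansion of `g` with respect to `(u, y)` in which
only the variables `u` occur, that is, `S ⊆ ℕ ^ d × {0}`. -/
structure IsPartialCPExpansion {R : Type*} [CommRing R] [IsLocalRing R] {d e : ℕ}
    (u : Fin d → R) (y : Fin e → R) (g : R)
    (S : Finset (Fin d ⊕ Fin e → ℕ)) (c : (Fin d ⊕ Fin e → ℕ) → R) : Prop where
  isRegularSystemOfParameters : IsRegularSystemOfParameters (Sum.elim u y)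
  isCPExpansion : IsCPExpansion (Sum.elim u y) g S c
  support : ∀ α ∈ S, ∀ j : Fin e, α (Sum.inr j) = 0

/-! Let `r` be the least `|α|` and `F` the form made of the terms of degree `r`. Its coefficients
are units, so `F` is nonzero over the residue field, and `g' ≡ F(u')` modulo `𝔪' ^ (r + 1)`. The key
is analytic independence (`map_residue_eq_zero_of_eval_mem_pow`): since `d = dim R'` elements
generate a reduction of `𝔪'`, no form nonzero over the residue field drops into the next power of
`𝔪'` at `u'`. Applied to `F ^ n`, again nonzero over a field, it gives `g'` powers of order exactly
`r * n`, so the limit is `r`. The case `n = 1` also bounds the order of `g` in `R`, because `𝔪` maps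
into `𝔪'`.

Analytic independence is proved at a generic point: over `A[X]` localized at `𝔪A[X]` a form with
nonzero reduction takes a unit value at `X`. Eliminating one `u i` there would force the dimension
below `d`, while it is at least `dim A`. -/

open MvPolynomial in
theorem MvPolynomial.eval_sub_eval_mem {σ A : Type*} [CommRing A] (J : Ideal A)
    (F : MvPolynomial σ A) {f g : σ → A} (h : ∀ i, f i - g i ∈ J) :
    eval f F - eval g F ∈ J := by
  rw [← Ideal.Quotient.eq, map_eval, map_eval]
  congr 2
  funext i
  exact Ideal.Quotient.eq.2 (h i)

open MvPolynomial in
theorem MvPolynomial.IsHomogeneous.eval_mul_left {σ A : Type*} [CommRing A]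
    {F : MvPolynomial σ A} {r : ℕ} (hF : F.IsHomogeneous r) (a : A) (f : σ → A) :
    eval (fun i => a * f i) F = a ^ r * eval f F := by
  rw [eval_eq, eval_eq, Finset.mul_sum]
  refine Finset.sum_congr rfl fun α hα => ?_
  have h : ∑ i ∈ α.support, α i = r := by
    have := hF (mem_support_iff.1 hα)
    simpa [Finsupp.weight_apply, Finsupp.sum] using this
  simp_rw [mul_pow, Finset.prod_mul_distrib, Finset.prod_pow_eq_pow_sum, h]
  ring

/-- In the expanded power every term other than `K ^ r` has a factor `J`. -/
theorem Ideal.sup_pow_le_sup_pow {A : Type*} [CommRing A] (J K : Ideal A) (r : ℕ) :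
    (J ⊔ K) ^ r ≤ J ⊔ K ^ r := by
  induction r with
  | zero => simp
  | succ r ih =>
    calc (J ⊔ K) ^ (r + 1) = (J ⊔ K) ^ r * (J ⊔ K) := pow_succ _ _
      _ ≤ (J ⊔ K ^ r) * (J ⊔ K) := Ideal.mul_mono_left ih
      _ = J * (J ⊔ K) ⊔ (K ^ r * J ⊔ K ^ r * K) := by rw [Ideal.sup_mul, Ideal.mul_sup (K ^ r)]
      _ ≤ J ⊔ K ^ (r + 1) := by
        refine sup_le ?_ (sup_le ?_ ?_)
        · exact le_sup_of_le_left Ideal.mul_le_left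
        · exact le_sup_of_le_left Ideal.mul_le_right
        · rw [pow_succ]; exact le_sup_right

theorem Ideal.pow_mul_pow_eq_of_mul_pow_eq {A : Type*} [CommRing A] {I J : Ideal A} {n : ℕ}
    (h : I * J ^ n = J ^ (n + 1)) (r : ℕ) : I ^ r * J ^ n = J ^ (r + n) := by
  induction r with
  | zero => simp
  | succ r ih =>
    rw [pow_succ, mul_assoc, h, pow_succ, ← mul_assoc, ih, ← pow_succ]
    congr 1
    omega

/-! ### Analytic independence of the generators of a reduction -/

open MvPolynomial IsLocalRing in
/-- If a form of degree `r` takes a value in `𝔪 ^ (r + 1)` on the generators of a reduction of the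
maximal ideal, and a unit value somewhere, then one of the generators is superfluous up to
radical. -/
theorem ringKrullDim_lt_card_of_isHomogeneous {B ι : Type*} [CommRing B] [IsLocalRing B]
    [IsNoetherianRing B] [Fintype ι] (u : ι → B)
    (hred : IsIdealReduction (Ideal.span (Set.range u)) (maximalIdeal B))
    {F : MvPolynomial ι B} {r : ℕ} (hF : F.IsHomogeneous r)
    (hu : eval u F ∈ maximalIdeal B ^ (r + 1)) {x : ι → B} (hx : IsUnit (eval x F))
    {i₀ : ι} (hi₀ : IsUnit (x i₀)) : ringKrullDim B < Fintype.card ι := by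
  classical
  obtain ⟨hle, n, hn⟩ := hred
  set M := maximalIdeal B with hM
  set v : ι → B := fun i => x i₀ * u i - u i₀ * x i with hv
  set s : Set B := v '' {i₀}ᶜ with hs
  set J := Ideal.span s with hJ
  have huM (i) : u i ∈ M := hle (Ideal.subset_span ⟨i, rfl⟩)
  have hvJ (i) : v i ∈ J := by
    by_cases h : i = i₀
    · subst h
      have : v i = 0 := by simp only [hv]; ring
      rw [this]; exact J.zero_mem
    · exact Ideal.subset_span ⟨i, h, rfl⟩
  have hJM : J ≤ M := by
    rw [hJ, Ideal.span_le]
    rintro _ ⟨i, -, rfl⟩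
    exact sub_mem (M.mul_mem_left _ (huM i)) (M.mul_mem_right _ (huM i₀))
  have hI : Ideal.span (Set.range u) ≤ J ⊔ Ideal.span {u i₀} := by
    rw [Ideal.span_le]
    rintro _ ⟨i, rfl⟩
    rw [SetLike.mem_coe, ← Ideal.unit_mul_mem_iff_mem _ hi₀]
    have : x i₀ * u i = v i + u i₀ * x i := by simp only [hv]; ring
    rw [this]
    exact add_mem (Ideal.mem_sup_left (hvJ i)) (Ideal.mem_sup_right
      (Ideal.mul_mem_right _ _ (Ideal.mem_span_singleton_self _)))
  -- Modulo `J` the vectors `x i₀ * u` and `u i₀ * x` agree, so homogeneity gives `x i₀ ^ r * F(u) ≡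
  -- u i₀ ^ r * F(x)`, where `F(x)` is a unit.
  have hpow : u i₀ ^ r ∈ J ⊔ M ^ (r + 1) := by
    rw [← Ideal.mul_unit_mem_iff_mem _ hx, ← hF.eval_mul_left]
    have h := eval_sub_eval_mem J F hvJ
    rw [hF.eval_mul_left] at h
    rw [← sub_sub_cancel (x i₀ ^ r * eval u F) (eval (fun i => u i₀ * x i) F)]
    exact sub_mem (Ideal.mem_sup_right (Ideal.mul_mem_left _ _ hu)) (Ideal.mem_sup_left h)
  -- By Nakayama it suffices to work modulo `M ^ (r + n + 1)`.
  have hMJ : M ^ (r + n) ≤ J := by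
    refine Submodule.le_of_le_smul_of_le_jacobson_bot (I := M) (IsNoetherian.noetherian _)
      (IsLocalRing.maximalIdeal_le_jacobson _) ?_
    rw [smul_eq_mul, ← pow_succ']
    calc M ^ (r + n) = Ideal.span (Set.range u) ^ r * M ^ n :=
          (Ideal.pow_mul_pow_eq_of_mul_pow_eq hn r).symm
      _ ≤ (J ⊔ Ideal.span {u i₀}) ^ r * M ^ n := Ideal.mul_mono_left (Ideal.pow_right_mono hI r)
      _ ≤ (J ⊔ Ideal.span {u i₀} ^ r) * M ^ n :=
          Ideal.mul_mono_left (Ideal.sup_pow_le_sup_pow _ _ _)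
      _ ≤ (J ⊔ M ^ (r + 1)) * M ^ n := by
          refine Ideal.mul_mono_left (sup_le le_sup_left ?_)
          rw [Ideal.span_singleton_pow, Ideal.span_singleton_le_iff_mem]
          exact hpow
      _ ≤ J ⊔ M ^ (r + n + 1) := by
          rw [Ideal.sup_mul, ← pow_add]
          refine sup_le (Ideal.mul_le_left.trans le_sup_left) ?_
          rw [add_right_comm]
          exact le_sup_right
  have hmin : M ∈ J.minimalPrimes := by
    refine ⟨⟨inferInstance, hJM⟩, fun q hq _ => ?_⟩
    have := hq.1
    exact Ideal.IsPrime.le_of_pow_le (hMJ.trans hq.2)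
  -- Krull's height theorem; `J` needs one generator fewer than `u` has members because `v i₀ = 0`.
  have hht := Ideal.height_le_card_of_mem_minimalPrimes_span (Set.toFinite s) hmin
  rw [← maximalIdeal_height_eq_ringKrullDim]
  have hcard : s.ncard < Fintype.card ι := by
    refine (Set.ncard_image_le (Set.toFinite _)).trans_lt ?_
    rw [← Nat.card_eq_fintype_card, ← Set.ncard_univ]
    exact Set.ncard_lt_ncard ((Set.ssubset_univ_iff).2 (by simp))
  exact_mod_cast hht.trans_lt (by exact_mod_cast hcard)

-- The extension `A → A[X]` is flat, hence has going down, and the extended prime contracts to `p`,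
-- as constant coefficients show.
open MvPolynomial in
theorem MvPolynomial.height_le_height_map_C {A ι : Type*} [CommRing A] [IsNoetherianRing A]
    [Finite ι] (p : Ideal A) [p.IsPrime] [(p.map (C : A →+* MvPolynomial ι A)).IsPrime] :
    p.height ≤ (p.map (C : A →+* MvPolynomial ι A)).height := by
  have : (p.map (C : A →+* MvPolynomial ι A)).LiesOver p := by
    refine ⟨le_antisymm Ideal.le_comap_map fun x hx => ?_⟩
    have h := mem_map_C_iff.1 (show C x ∈ p.map (C : A →+* MvPolynomial ι A) from hx) 0
    simpa using h
  rw [Ideal.height_eq_height_add_of_liesOver_of_hasGoingDown p (p.map (C : A →+* MvPolynomial ι A))]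
  exact le_self_add

open MvPolynomial IsLocalRing in
/-- Analytic independence: if the maximal ideal of a Noetherian local ring of dimension `d` has a
reduction generated by `d` elements `u`, then a form of degree `r` whose value at `u` lies in
`𝔪 ^ (r + 1)` vanishes modulo `𝔪`. -/
theorem map_residue_eq_zero_of_eval_mem_pow {A ι : Type*} [CommRing A] [IsLocalRing A]
    [IsNoetherianRing A] [Fintype ι] (hdim : ringKrullDim A = Fintype.card ι) (u : ι → A)
    (hred : IsIdealReduction (Ideal.span (Set.range u)) (maximalIdeal A))
    {F : MvPolynomial ι A} {r : ℕ} (hF : F.IsHomogeneous r)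
    (hu : eval u F ∈ maximalIdeal A ^ (r + 1)) : map (residue A) F = 0 := by
  set p : Ideal (MvPolynomial ι A) := (maximalIdeal A).map C with hp
  have hker : RingHom.ker (map (residue A) : MvPolynomial ι A →+* _) = p := by
    rw [ker_map, ker_residue]
  have : p.IsPrime := hker ▸ RingHom.ker_isPrime _
  by_contra hne
  have hFp : F ∉ p := by rwa [← hker, RingHom.mem_ker]
  -- Without variables there is no `i₀` to eliminate, but then `F` is a constant lying in the
  -- maximal ideal.
  rcases isEmpty_or_nonempty ι with hι | ⟨⟨i₀⟩⟩
  · rw [eq_C_of_isEmpty F] at hu hFp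
    rw [eval_C] at hu
    exact hFp (Ideal.mem_map_of_mem _ (Ideal.pow_le_self (by simp) hu))
  let B := Localization.AtPrime p
  have hM : (maximalIdeal A).map ((algebraMap (MvPolynomial ι A) B).comp C) = maximalIdeal B := by
    rw [← Ideal.map_map, ← hp, IsLocalization.AtPrime.map_eq_maximalIdeal p B]
  set φ : A →+* B := (algebraMap (MvPolynomial ι A) B).comp C with hφ
  have : IsNoetherianRing B := IsLocalization.isNoetherianRing p.primeCompl B inferInstance
  have hunit {f : MvPolynomial ι A} (hf : f ∉ p) : IsUnit (algebraMap _ B f) :=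
    IsLocalization.map_units B (⟨f, hf⟩ : p.primeCompl)
  have hX : (X i₀ : MvPolynomial ι A) ∉ p := by
    rw [← hker, RingHom.mem_ker, map_X]
    exact X_ne_zero _
  have hdB : ringKrullDim B < Fintype.card ι := by
    refine ringKrullDim_lt_card_of_isHomogeneous (fun i => φ (u i)) ?_ (F := map φ F) (hF.map φ) ?_
      (x := fun i => algebraMap _ B (X i)) ?_ (i₀ := i₀) (hunit hX)
    · obtain ⟨hle, n, hn⟩ := hred
      have hspan : Ideal.span (Set.range fun i => φ (u i)) = (Ideal.span (Set.range u)).map φ := by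
        rw [Ideal.map_span, ← Set.range_comp]; rfl
      rw [hspan, ← hM]
      refine ⟨Ideal.map_mono hle, n, ?_⟩
      rw [← Ideal.map_pow, ← Ideal.map_mul, hn, Ideal.map_pow]
    · have := map_eval φ u F
      rw [← hM, ← Ideal.map_pow]
      rw [show (fun i => φ (u i)) = φ ∘ u from rfl, ← this]
      exact Ideal.mem_map_of_mem _ hu
    -- Evaluating at the variables returns `F` itself, a unit since it lies outside `p`.
    · have h : eval (fun i => algebraMap (MvPolynomial ι A) B (X i)) (map φ F)
          = algebraMap _ B F := by
        rw [hφ, ← MvPolynomial.map_map]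
        have := map_eval (algebraMap (MvPolynomial ι A) B) X (map C F)
        rw [show (fun i => algebraMap (MvPolynomial ι A) B (X i))
          = algebraMap (MvPolynomial ι A) B ∘ X from rfl, ← this, eval_map, eval₂_eta]
      rw [h]
      exact hunit hFp
  rw [IsLocalization.AtPrime.ringKrullDim_eq_height p B, ← hdim,
    ← maximalIdeal_height_eq_ringKrullDim] at hdB
  exact hdB.not_ge (WithBot.coe_le_coe.2 (height_le_height_map_C (maximalIdeal A)))

/-! ### Orders of powers and their limits -/

theorem natCast_le_idealOrder {A : Type*} [CommRing A] {I : Ideal A} {f : A} {r : ℕ}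
    (h : f ∈ I ^ r) : (r : ℕ∞) ≤ idealOrder I f :=
  le_iSup₂_of_le r h le_rfl

theorem idealOrder_eq_natCast {A : Type*} [CommRing A] {I : Ideal A} {f : A} {r : ℕ}
    (h : f ∈ I ^ r) (h' : f ∉ I ^ (r + 1)) : idealOrder I f = r := by
  refine le_antisymm (iSup₂_le fun l hl => ?_) (natCast_le_idealOrder h)
  by_contra hlt
  have : r + 1 ≤ l := by
    rw [not_le] at hlt
    exact_mod_cast hlt
  exact h' (Ideal.pow_le_pow_right this hl)

theorem idealOrder_zero {A : Type*} [CommRing A] (I : Ideal A) : idealOrder I 0 = ⊤ :=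
  ENat.eq_top_iff_forall_ge.2 fun _ => natCast_le_idealOrder (zero_mem _)

open MvPolynomial IsLocalRing in
theorem MvPolynomial.IsHomogeneous.eval_mem_pow {A ι : Type*} [CommRing A] {I : Ideal A} {u : ι → A}
    (hu : ∀ i, u i ∈ I) {F : MvPolynomial ι A} {r : ℕ} (hF : F.IsHomogeneous r) :
    eval u F ∈ I ^ r := by
  rw [eval_eq]
  refine sum_mem fun α hα => Ideal.mul_mem_left _ _ ?_
  have h : ∑ i ∈ α.support, α i = r := by
    have := hF (mem_support_iff.1 hα)
    simpa [Finsupp.weight_apply, Finsupp.sum] using this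
  rw [← h, ← Finset.prod_pow_eq_pow_sum]
  exact Ideal.prod_mem_prod fun i _ => Ideal.pow_mem_pow (hu i) _

open MvPolynomial IsLocalRing in
/-- An element whose initial form does not vanish in the residue field has powers of the
expected order. -/
theorem pow_mem_pow_and_notMem_pow {A ι : Type*} [CommRing A] [IsLocalRing A]
    [IsNoetherianRing A] [Fintype ι] (hdim : ringKrullDim A = Fintype.card ι) (u : ι → A)
    (hred : IsIdealReduction (Ideal.span (Set.range u)) (maximalIdeal A))
    {F : MvPolynomial ι A} {r : ℕ} (hF : F.IsHomogeneous r) (hF0 : map (residue A) F ≠ 0)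
    {g : A} (hg : g - eval u F ∈ maximalIdeal A ^ (r + 1)) (n : ℕ) :
    g ^ n ∈ maximalIdeal A ^ (r * n) ∧ g ^ n ∉ maximalIdeal A ^ (r * n + 1) := by
  set M := maximalIdeal A
  have hu (i) : u i ∈ M := hred.1 (Ideal.subset_span ⟨i, rfl⟩)
  have hFr : eval u F ∈ M ^ r := hF.eval_mem_pow hu
  have hgr : g ∈ M ^ r := by
    rw [← sub_add_cancel g (eval u F)]
    exact add_mem (Ideal.pow_le_pow_right (Nat.le_succ r) hg) hFr
  refine ⟨by rw [pow_mul]; exact Ideal.pow_mem_pow hgr n, fun h => ?_⟩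
  have hdiff (n : ℕ) : g ^ n - eval u F ^ n ∈ M ^ (r * n + 1) := by
    induction n with
    | zero => simp
    | succ n ih =>
      have : g ^ (n + 1) - eval u F ^ (n + 1)
          = g ^ n * (g - eval u F) + (g ^ n - eval u F ^ n) * eval u F := by ring
      rw [this]
      refine add_mem ?_ ?_
      · rw [show r * (n + 1) + 1 = r * n + (r + 1) by ring, pow_add, pow_mul M]
        exact Ideal.mul_mem_mul (Ideal.pow_mem_pow hgr n) hg
      · rw [show r * (n + 1) + 1 = (r * n + 1) + r by ring, pow_add]
        exact Ideal.mul_mem_mul ih hFr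
  have h0 := map_residue_eq_zero_of_eval_mem_pow hdim u hred (hF.pow n) (by
    rw [map_pow, ← sub_sub_cancel (g ^ n) (eval u F ^ n)]
    exact sub_mem h (hdiff n))
  rw [map_pow] at h0
  exact hF0 (eq_zero_of_pow_eq_zero h0)

theorem tendsto_natCast_mul_div_natCast (r : ℕ) :
    Tendsto (fun n : ℕ => (((r * n : ℕ) : ℕ∞) : ℝ≥0∞) / (n : ℝ≥0∞)) atTop (𝓝 (r : ℝ≥0∞)) := by
  refine tendsto_const_nhds.congr' ?_
  filter_upwards [eventually_ne_atTop 0] with n hn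
  rw [ENat.toENNReal_coe, Nat.cast_mul,
    ENNReal.mul_div_cancel_right (by exact_mod_cast hn) (ENNReal.natCast_ne_top n)]

theorem tendsto_idealOrder_zero_pow_div {A : Type*} [CommRing A] (I : Ideal A) :
    Tendsto (fun n : ℕ => (idealOrder I (0 ^ n) : ℝ≥0∞) / (n : ℝ≥0∞)) atTop (𝓝 ⊤) := by
  refine tendsto_const_nhds.congr' ?_
  -- The index `0` must be excluded, since `0 ^ 0 = 1`.
  filter_upwards [eventually_ne_atTop 0] with n hn
  rw [zero_pow hn, idealOrder_zero, ENat.toENNReal_top,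
    ENNReal.top_div_of_ne_top (ENNReal.natCast_ne_top n)]

/-- `limUnder` is meaningful only once convergence is known; limits in `ℝ≥0∞` are unique. -/
theorem tendsto_asymptoticSamuel_and_eq {A : Type*} [CommRing A] {I : Ideal A} {f : A} {b : ℝ≥0∞}
    (h : Tendsto (fun n : ℕ => (idealOrder I (f ^ n) : ℝ≥0∞) / (n : ℝ≥0∞)) atTop (𝓝 b)) :
    Tendsto (fun n : ℕ => (idealOrder I (f ^ n) : ℝ≥0∞) / (n : ℝ≥0∞)) atTop
      (𝓝 (asymptoticSamuel I f)) ∧ asymptoticSamuel I f = b := by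
  have : asymptoticSamuel I f = b := h.limUnder_eq
  exact ⟨this ▸ h, this⟩

/-! ### Initial forms of expansions and the conclusion -/

theorem systemMonomial_sumElim_zero {R ι κ : Type*} [CommRing R] [Fintype ι] [Fintype κ]
    (u : ι → R) (y : κ → R) (α : ι → ℕ) :
    systemMonomial (Sum.elim u y) (Sum.elim α 0) = systemMonomial u α := by
  simp [systemMonomial, Fintype.prod_sum_type]

theorem systemMonomial_mem_pow {R ι : Type*} [CommRing R] [Fintype ι] {I : Ideal R} {u : ι → R}
    (hu : ∀ i, u i ∈ I) (α : ι → ℕ) : systemMonomial u α ∈ I ^ ∑ i, α i := by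
  rw [systemMonomial, ← Finset.prod_pow_eq_pow_sum]
  exact Ideal.prod_mem_prod fun i _ => Ideal.pow_mem_pow (hu i) _

theorem map_systemMonomial {R R' ι : Type*} [CommRing R] [CommRing R'] [Fintype ι] (φ : R →+* R')
    (u : ι → R) (α : ι → ℕ) : φ (systemMonomial u α) = systemMonomial (fun i => φ (u i)) α := by
  simp [systemMonomial]

open MvPolynomial IsLocalRing in
/-- The sum of the terms of lowest degree of a finite expansion with unit coefficients is an
initial form that does not vanish in the residue field. -/
theorem exists_isHomogeneous_map_residue_ne_zero {A ι : Type*} [CommRing A] [IsLocalRing A]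
    [Fintype ι] {u : ι → A} (hu : ∀ i, u i ∈ maximalIdeal A) (T : Finset (ι → ℕ))
    {c : (ι → ℕ) → A} (hc : ∀ α ∈ T, IsUnit (c α)) {α₀ : ι → ℕ} (hα₀ : α₀ ∈ T)
    (hmin : ∀ α ∈ T, ∑ i, α₀ i ≤ ∑ i, α i) :
    ∃ F : MvPolynomial ι A, F.IsHomogeneous (∑ i, α₀ i) ∧ map (residue A) F ≠ 0 ∧
      (∑ α ∈ T, c α * systemMonomial u α) - eval u F ∈ maximalIdeal A ^ (∑ i, α₀ i + 1) := by
  classical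
  set r := ∑ i, α₀ i
  let E : (ι → ℕ) → (ι →₀ ℕ) := Finsupp.equivFunOnFinite.symm
  refine ⟨∑ α ∈ T with ∑ i, α i = r, monomial (E α) (c α), ?_, ?_, ?_⟩
  · refine IsHomogeneous.sum _ _ _ fun α hα => isHomogeneous_monomial _ ?_
    rw [Finsupp.degree_eq_sum]
    exact (Finset.mem_filter.1 hα).2
  · intro h
    -- The coefficient at `α₀` is the residue of the unit `c α₀`, as distinct exponents cannot
    -- cancel.
    have h' := congrArg (coeff (E α₀)) h
    rw [coeff_map, coeff_sum, coeff_zero] at h'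
    simp_rw [coeff_monomial, E, Equiv.apply_eq_iff_eq] at h'
    have hmem : α₀ ∈ T.filter fun α => ∑ i, α i = r := Finset.mem_filter.2 ⟨hα₀, rfl⟩
    rw [Finset.sum_ite_eq', if_pos hmem] at h'
    exact ((hc α₀ hα₀).map (residue A)).ne_zero h'
  · have heval : eval u (∑ α ∈ T with ∑ i, α i = r, monomial (E α) (c α))
        = ∑ α ∈ T with ∑ i, α i = r, c α * systemMonomial u α := by
      rw [map_sum]
      refine Finset.sum_congr rfl fun α _ => ?_
      rw [eval_monomial, Finsupp.prod_fintype _ _ (by simp)]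
      rfl
    rw [heval, ← Finset.sum_filter_add_sum_filter_not T (fun α => ∑ i, α i = r), add_sub_cancel_left]
    refine sum_mem fun α hα => Ideal.mul_mem_left _ _ ?_
    obtain ⟨hα, hne⟩ := Finset.mem_filter.1 hα
    exact Ideal.pow_le_pow_right (Nat.lt_of_le_of_ne (hmin α hα) (Ne.symm hne))
      (systemMonomial_mem_pow hu α)

theorem IsPartialCPExpansion.eq_sum_preimage {R : Type*} [CommRing R] [IsLocalRing R] {d e : ℕ}
    {u : Fin d → R} {y : Fin e → R} {g : R} {S : Finset (Fin d ⊕ Fin e → ℕ)}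
    {c : (Fin d ⊕ Fin e → ℕ) → R} (hg : IsPartialCPExpansion u y g S c)
    (T : Finset (Fin d → ℕ)) (hT : ∀ α, α ∈ T ↔ Sum.elim α (0 : Fin e → ℕ) ∈ S) :
    g = ∑ α ∈ T, c (Sum.elim α 0) * systemMonomial u α := by
  rw [hg.isCPExpansion.eq_sum]
  have hS (β) (hβ : β ∈ S) : Sum.elim (β ∘ Sum.inl) (0 : Fin e → ℕ) = β := by
    funext j
    cases j with
    | inl i => rfl
    | inr j => exact (hg.support β hβ j).symm
  refine Finset.sum_bij' (fun β _ => β ∘ Sum.inl) (fun α _ => Sum.elim α 0)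
    (fun β hβ => (hT _).2 ((hS β hβ).symm ▸ hβ)) (fun α hα => (hT α).1 hα) hS
    (fun α _ => rfl) fun β hβ => ?_
  rw [← systemMonomial_sumElim_zero u y, hS β hβ]

theorem proposition4p10 {R : Type*} [CommRing R] [IsRegularLocalRing R] {d e : ℕ}
    (u : Fin d → R) (a : Ideal R) [IsLocalRing (R ⧸ a)]
    (hdim : ringKrullDim (R ⧸ a) = d)
    (hred : IsIdealReduction (Ideal.span (Set.range fun i => Ideal.Quotient.mk a (u i)))
      (IsLocalRing.maximalIdeal (R ⧸ a)))
    (g : R) (y : Fin e → R)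
    (S : Finset (Fin d ⊕ Fin e → ℕ)) (c : (Fin d ⊕ Fin e → ℕ) → R)
    (hg : IsPartialCPExpansion u y g S c) :
    -- the limit that defines the asymptotic Samuel function exists
    Tendsto (fun n : ℕ => (idealOrder (IsLocalRing.maximalIdeal (R ⧸ a))
        (Ideal.Quotient.mk a g ^ n) : ℝ≥0∞) / (n : ℝ≥0∞)) atTop
      (𝓝 (asymptoticSamuel (IsLocalRing.maximalIdeal (R ⧸ a)) (Ideal.Quotient.mk a g))) ∧
    asymptoticSamuel (IsLocalRing.maximalIdeal (R ⧸ a)) (Ideal.Quotient.mk a g) =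
      (idealOrder (IsLocalRing.maximalIdeal R) g : ℝ≥0∞) ∧
    idealOrder (IsLocalRing.maximalIdeal R) g =
      ⨅ α : {α : Fin d → ℕ // Sum.elim α (0 : Fin e → ℕ) ∈ S}, ((∑ i, α.1 i : ℕ) : ℕ∞) := by
  classical
  let T : Finset (Fin d → ℕ) := S.preimage (fun α => Sum.elim α (0 : Fin e → ℕ))
    (fun α _ β _ h => congrArg (fun f => f ∘ Sum.inl) h)
  have hT (α) : α ∈ T ↔ Sum.elim α (0 : Fin e → ℕ) ∈ S := Finset.mem_preimage
  have hgT := hg.eq_sum_preimage T hT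
  rcases T.eq_empty_or_nonempty with hT0 | hTne
  · have hg0 : g = 0 := by rw [hgT, hT0, Finset.sum_empty]
    have : IsEmpty {α : Fin d → ℕ // Sum.elim α (0 : Fin e → ℕ) ∈ S} :=
      ⟨fun α => Finset.notMem_empty _ (hT0 ▸ (hT α.1).2 α.2)⟩
    rw [hg0, map_zero, idealOrder_zero, ENat.toENNReal_top, iInf_of_empty]
    obtain ⟨h₁, h₂⟩ := tendsto_asymptoticSamuel_and_eq
      (tendsto_idealOrder_zero_pow_div (IsLocalRing.maximalIdeal (R ⧸ a)))
    exact ⟨h₁, h₂, rfl⟩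
  obtain ⟨α₀, hα₀, hmin⟩ := T.exists_min_image (fun α => ∑ i, α i) hTne
  set r := ∑ i, α₀ i
  have huR (i) : u i ∈ IsLocalRing.maximalIdeal R := by
    rw [← hg.isRegularSystemOfParameters.1]
    exact Ideal.subset_span ⟨Sum.inl i, rfl⟩
  have hu' (i) : Ideal.Quotient.mk a (u i) ∈ IsLocalRing.maximalIdeal (R ⧸ a) :=
    hred.1 (Ideal.subset_span ⟨i, rfl⟩)
  have hunit (α) (hα : α ∈ T) : IsUnit (c (Sum.elim α 0)) :=
    hg.isCPExpansion.isUnit_coeff _ ((hT α).1 hα)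
  have hmap (k : ℕ) {f : R} (hf : f ∈ IsLocalRing.maximalIdeal R ^ k) :
      Ideal.Quotient.mk a f ∈ IsLocalRing.maximalIdeal (R ⧸ a) ^ k := by
    have hle := (IsLocalRing.map_maximalIdeal_of_surjective (Ideal.Quotient.mk a)
      Ideal.Quotient.mk_surjective).le
    exact Ideal.pow_right_mono hle k (Ideal.map_pow (Ideal.Quotient.mk a) _ k ▸
      Ideal.mem_map_of_mem _ hf)
  have hg' : Ideal.Quotient.mk a g = ∑ α ∈ T, Ideal.Quotient.mk a (c (Sum.elim α 0)) *
      systemMonomial (fun i => Ideal.Quotient.mk a (u i)) α := by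
    simp_rw [hgT, map_sum, map_mul, map_systemMonomial]
  obtain ⟨F, hF, hF0, hgF⟩ := exists_isHomogeneous_map_residue_ne_zero hu' T
    (c := fun α => Ideal.Quotient.mk a (c (Sum.elim α 0)))
    (fun α hα => (hunit α hα).map _) hα₀ hmin
  rw [← hg'] at hgF
  have hpow := pow_mem_pow_and_notMem_pow (by rw [hdim, Fintype.card_fin]) _ hred hF hF0 hgF
  have hord : idealOrder (IsLocalRing.maximalIdeal R) g = r := by
    refine idealOrder_eq_natCast ?_ fun h => ?_
    · rw [hgT]
      exact sum_mem fun α hα => Ideal.mul_mem_left _ _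
        (Ideal.pow_le_pow_right (hmin α hα) (systemMonomial_mem_pow huR α))
    -- Membership of `g` in `𝔪 ^ (r + 1)` would pass to the quotient.
    · have := (hpow 1).2
      rw [pow_one, mul_one] at this
      exact this (hmap _ h)
  have hlim : Tendsto (fun n : ℕ => (idealOrder (IsLocalRing.maximalIdeal (R ⧸ a))
      (Ideal.Quotient.mk a g ^ n) : ℝ≥0∞) / (n : ℝ≥0∞)) atTop (𝓝 (r : ℝ≥0∞)) := by
    simp_rw [fun n => idealOrder_eq_natCast (hpow n).1 (hpow n).2]
    exact tendsto_natCast_mul_div_natCast r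
  obtain ⟨h₁, h₂⟩ := tendsto_asymptoticSamuel_and_eq hlim
  refine ⟨h₁, ?_, ?_⟩
  · rw [h₂, hord, ENat.toENNReal_coe]
  · rw [hord]
    refine le_antisymm (le_iInf fun α => ?_) (iInf_le_of_le ⟨α₀, (hT α₀).1 hα₀⟩ le_rfl)
    exact_mod_cast hmin α.1 ((hT _).2 α.2)
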